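/- **Theorem.** Consider structures $\mathfrak M=\langle B,Q;\mathrm{Ob},\mathrm{IOb},\mathrm{Ph},+,\cdot,\le,W\rangle$, where $B$ (bodies) and $Q$ (quantities) are nonempty sets, $\mathrm{Ob}$ (observers), $\mathrm{IOb}$ (inertial observers) and $\mathrm{Ph}$ (light signals) are subsets of $B$, $+$ and $\cdot$ are binary operations on $Q$, $\le$ is a binary relation on $Q$, and $W\subseteq B\times B\times Q^3$ is the worldview relation ($W(k,b,\bar x)$ means: $k$ coordinatizes $b$ at the point $\bar x=\langle x_1,x_2,x_3\rangle$, at instant $x_1$ and space location $\langle x_2,x_3\rangle$). The structure $\langle Q,+,\cdot,\le\rangle$ is the *quantity part* of $\mathfrak M$. If it is an ordered field, put $\mathrm{time}(\bar x,\bar y)=x_1-y_1$ and $\mathrm{space}^2(\bar x,\bar y)=(x_2-y_2)^2+(x_3-y_3)^2$. The axiom system $\mathsf{SpecRel}_0+\mathsf{AxThExp}$ in dimension $3$ consists of the following axioms. * $\mathsf{AxOField}$: $\langle Q,+,\cdot,\le\rangle$ is a (linearly) ordered field. * $\mathsf{AxPh}$: for every $m\in\mathrm{IOb}$ there is $c_m\in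 Q$ with $c_m>0$ such that for all $\bar x,\bar y\in Q^3$: there is $p\in\mathrm{Ph}$ with $W(m,p,\bar x)$ and $W(m,p,\bar y)$ if and only if $\mathrm{space}^2(\bar x,\bar y)=c_m^2\cdot\mathrm{time}(\bar x,\bar y)^2$. (This $c_m$ is unique; it is the speed of light according to $m$, and it may depend on $m$.) * $\mathsf{AxEv}$: for all $m,k\in\mathrm{IOb}$ and $\bar x\in Q^3$ there is $\bar y\in Q^3$ such that for all $b\in B$: $W(m,b,\bar x)$ if and only if $W(k,b,\bar y)$. * $\mathsf{AxSelf}$: for all $m\in\mathrm{IOb}$ and $\bar x\in Q^3$: $W(m,m,\bar x)$ if and only if $x_2=x_3=0$. * $\mathsf{AxThExp}$: $\mathrm{IOb}\neq\emptyset$, and for all $m\in\mathrm{IOb}$ and $\bar x,\bar y\in Q^3$ with $\mathrm{space}^2(\bar x,\bar y)<c_m^2\cdot\mathrm{time}(\bar x,\bar y)^2$ there is $k\in\mathrm{IOb}$ with $W(m,k,\bar x)$ and $W(m,k,\bar y)$. Let $\mathit{Num}_3(\mathsf{SpecRel}_0+\mathsf{AxThExp})$ be the class of the quantity parts of all models of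 these axioms. Then $$\mathit{Num}_3(\mathsf{SpecRel}_0+\mathsf{AxThExp})=\{\text{Euclidean fields}\},$$ where a Euclidean field is an ordered field in which every positive element has a square root. That is, the quantity part of every such model is a Euclidean field, and every Euclidean field is the quantity part of such a model. -/

import Mathlib

universe u

namespace SpaceTime

/-- A structure `⟨Q, +, ·, ≤⟩` for the quantity sort: a nonempty set with two binary operations
and a binary relation, on which no laws are imposed. -/
structure QuantityStructure where
  /-- the set `Q` of quantities -/
  carrier : Type u
  nonempty : Nonempty carrier
  add : carrier → carrier → carrier
  mul : carrier → carrier → carrier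
  le : carrier → carrier → Prop

/-- A (necessarily unique) way to see `⟨Q, +, ·, ≤⟩` as an ordered field: a linearly ordered
field structure on the set `Q` whose addition, multiplication and ordering are the given ones. -/
class OrderedFieldStructure (𝔔 : QuantityStructure.{u}) extends
    Field 𝔔.carrier, LinearOrder 𝔔.carrier, IsStrictOrderedRing 𝔔.carrier where
  add_eq : ∀ x y : 𝔔.carrier, x + y = 𝔔.add x y
  mul_eq : ∀ x y : 𝔔.carrier, x * y = 𝔔.mul x y
  le_iff : ∀ x y : 𝔔.carrier, x ≤ y ↔ 𝔔.le x y

/-- `⟨Q, +, ·, ≤⟩` is a Euclidean field: an ordered field in which every positive element has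
a square root. -/
def QuantityStructure.IsEuclideanField (𝔔 : QuantityStructure.{u}) : Prop :=
  ∃ _ : OrderedFieldStructure 𝔔, ∀ x : 𝔔.carrier, 0 < x → ∃ y : 𝔔.carrier, y ^ 2 = x

/-- Models of the two-sorted language `{B, Q; Ob, IOb, Ph, +, ·, ≤, W}` for spacetime
dimension `d`. Coordinate points are `d`-tuples indexed by `Fin d`; the coordinate with index `0`
is the time coordinate, all the others are spatial. -/
structure Model (d : ℕ) where
  /-- the quantity part `⟨Q, +, ·, ≤⟩` -/
  quantityPart : QuantityStructure.{u}
  /-- the set `B` of bodies -/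
  Body : Type u
  body_nonempty : Nonempty Body
  /-- observers -/
  Ob : Body → Prop
  /-- inertial observers -/
  IOb : Body → Prop
  /-- light signals -/
  Ph : Body → Prop
  /-- the worldview relation: `W k b x` says that `k` coordinatizes `b` at the point `x` -/
  W : Body → Body → (Fin d → quantityPart.carrier) → Prop

namespace Model

variable {d : ℕ}

/-- The quantities of a model. -/
abbrev Q (M : Model.{u} d) : Type u := M.quantityPart.carrier

/-- The event occurring for `m` at `x`: the set of bodies that `m` coordinatizes at `x`. -/
def ev (M : Model.{u} d) (m : M.Body) (x : Fin d → M.Q) : Set M.Body := {b | M.W m b x}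

/-- All inertial observers coordinatize the same set of events. -/
def AxEv (M : Model.{u} d) : Prop :=
  ∀ m k : M.Body, M.IOb m → M.IOb k → ∀ x : Fin d → M.Q, ∃ y : Fin d → M.Q, M.ev m x = M.ev k y

variable [NeZero d]

/-- Time difference of two coordinate points. -/
def time (M : Model.{u} d) [OrderedFieldStructure M.quantityPart] (x y : Fin d → M.Q) : M.Q :=
  x 0 - y 0

/-- Squared spatial distance of two coordinate points. -/
def space2 (M : Model.{u} d) [OrderedFieldStructure M.quantityPart] (x y : Fin d → M.Q) : M.Q :=
  ∑ i ∈ Finset.univ.erase (0 : Fin d), (x i - y i) ^ 2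

/-- For any inertial observer, the speed of light is a positive quantity which is the same
everywhere and in every direction, and light signals can be sent out everywhere and in every
direction. -/
def AxPh (M : Model.{u} d) [OrderedFieldStructure M.quantityPart] : Prop :=
  ∀ m : M.Body, M.IOb m → ∃ c : M.Q, 0 < c ∧ ∀ x y : Fin d → M.Q,
    (∃ p : M.Body, M.Ph p ∧ M.W m p x ∧ M.W m p y) ↔ M.space2 x y = c ^ 2 * M.time x y ^ 2

/-- `v` is the speed of light according to `m`. If `AxPh` holds, then for each inertial observer
`m` there is exactly one such `v`. -/
def IsLightSpeed (M : Model.{u} d) [OrderedFieldStructure M.quantityPart]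
    (m : M.Body) (v : M.Q) : Prop :=
  0 < v ∧ ∀ x y : Fin d → M.Q,
    (∃ p : M.Body, M.Ph p ∧ M.W m p x ∧ M.W m p y) → M.space2 x y = v ^ 2 * M.time x y ^ 2

/-- Any inertial observer is stationary relative to himself. -/
def AxSelf (M : Model.{u} d) [OrderedFieldStructure M.quantityPart] : Prop :=
  ∀ m : M.Body, M.IOb m → ∀ x : Fin d → M.Q, M.W m m x ↔ ∀ i : Fin d, i ≠ 0 → x i = 0

/-- There are inertial observers, and they can move along any straight line with any speed less
than the speed of light. -/
def AxThExp (M : Model.{u} d) [OrderedFieldStructure M.quantityPart] : Prop :=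
  (∃ h : M.Body, M.IOb h) ∧
    ∀ m : M.Body, M.IOb m → ∀ c : M.Q, M.IsLightSpeed m c → ∀ x y : Fin d → M.Q,
      M.space2 x y < c ^ 2 * M.time x y ^ 2 → ∃ k : M.Body, M.IOb k ∧ M.W m k x ∧ M.W m k y

/-- The axiom system `SpecRel₀ + AxThExp`, where `SpecRel₀` consists of `AxOField` (the quantity
part is an ordered field), `AxPh`, `AxEv` and `AxSelf`. -/
def SpecRel₀AxThExp (M : Model.{u} d) : Prop :=
  ∃ _ : OrderedFieldStructure M.quantityPart, M.AxPh ∧ M.AxEv ∧ M.AxSelf ∧ M.AxThExp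

end Model

/-- The class of the quantity parts of the `n`-dimensional models of the theory `Th`. -/
def Num (n : ℕ) (Th : Model.{u} n → Prop) : Set QuantityStructure.{u} :=
  {𝔔 | ∃ M : Model.{u} n, Th M ∧ M.quantityPart = 𝔔}

end SpaceTime

/-!
The worldview transformation between two inertial observers is a bijection that preserves
light-relatedness, so everything expressible by light signals is transported by it. In his own
coordinates, an inertial observer `k` is at rest, and his time axis can be completed to an
orthogonal frame whose construction uses light signals only. In the coordinates of another observer
`m`, this becomes a frame whose first vector `v` joins two points of the worldline of `k` and whose
Gram matrix is `diag(A, -A, …, -A)`, where `A` is the squared Minkowski length of `v`. As the Gram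
determinant is a square in odd dimensions, `A ^ d`, and hence `A`, is a square. Since observers can
move along every timelike line, every positive quantity is a square.

Conversely, over a Euclidean field every timelike line is taken to the time axis by a translation
followed by a reflection, so in Minkowski spacetime it is the worldline of an inertial observer.
-/

open LinearMap (BilinForm)

namespace SpaceTime

section BilinForm

variable {K V : Type*} [Field K] [AddCommGroup V] [Module K V] {B : BilinForm K V}

lemma bilinForm_sub_smul_self (hB : B.IsSymm) {w : V} (hw : B w w = 0) (z : V) (r : K) :
    B (z - r • w) (z - r • w) = B z z - 2 * r * B w z := by
  simp only [map_sub, map_smul, LinearMap.sub_apply, LinearMap.smul_apply, smul_eq_mul, hw,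
    hB.eq z w]
  ring

lemma exists_null_sub_smul_iff [NeZero (2 : K)] (hB : B.IsSymm) {w : V} (hw : B w w = 0) (z : V) :
    (∃ r : K, B (z - r • w) (z - r • w) = 0) ↔ B z z = 0 ∨ B w z ≠ 0 := by
  simp only [bilinForm_sub_smul_self hB hw]
  constructor
  · rintro ⟨r, hr⟩
    refine or_iff_not_imp_right.2 fun hwz => ?_
    rwa [not_not.1 hwz, mul_zero, sub_zero] at hr
  · rintro (hz | hwz)
    · exact ⟨0, by simp [hz]⟩
    · exact ⟨B z z / (2 * B w z), by field_simp; ring⟩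

lemma exists_isOrthogonal_apply_eq (hB : B.IsSymm) {x y : V} (h : B x x = B y y)
    (hxy : B (x - y) (x - y) ≠ 0) : ∃ σ : V ≃ₗ[K] V, B.IsOrthogonal σ ∧ σ x = y := by
  have hrefl : LinearMap.IsReflective B (x - y) :=
    ⟨.of_ne_zero hxy, fun z => dvd_mul_of_dvd_left (Dvd.intro _ (mul_inv_cancel_left₀ hxy 2)) _⟩
  have hcoroot : LinearMap.IsReflective.coroot B hrefl x = 1 := by
    refine mul_left_cancel₀ hxy ?_
    rw [LinearMap.IsReflective.apply_self_mul_coroot_apply]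
    simp only [map_sub, LinearMap.sub_apply, h, hB.eq y x]
    ring
  refine ⟨_, hrefl.isOrthogonal_reflection B (LinearMap.BilinForm.isSymm_iff.1 hB), ?_⟩
  rw [Module.reflection_apply, hcoroot, one_smul, sub_sub_cancel]

end BilinForm

section LightRelation

variable {P P' : Type*} {d : ℕ} [NeZero d]

/-- The intersection of the light cones with vertices `p` and `q`, for an abstract relation `R` of
being connectible by light. If `p` and `q` are distinct and light-related, this is the light line
through them. -/
def coneInter (R : P → P → Prop) (p q : P) : Set P := {z | R p z ∧ R q z}

/-- No point of the light line through `p` and `q` is light-related to `x`. In Minkowski spacetime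
this says that `x - p` is orthogonal to `q - p` but not null. -/
def LightFar (R : P → P → Prop) (p q x : P) : Prop := ∀ z ∈ coneInter R p q, ¬R z x

/-- The light lines through `p, q` and through `p', q'` are disjoint, and every point of the first
is light-related to a point of the second. In Minkowski spacetime this makes the lines parallel. -/
def LightParallel (R : P → P → Prop) (p q p' q' : P) : Prop :=
  ∀ z ∈ coneInter R p q, z ∉ coneInter R p' q' ∧ ∃ y ∈ coneInter R p' q', R y z

/-- An orthogonal frame with origin `o`, time axis through `a` and spatial axes through the `x i`,
described in terms of light relations only. The index `0` is not used. The model to keep in mind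
is `o = 0`, `a = 2 e₀`, `n i = e₀ + e i`, `n' i = e₀ - e i`, `x i = 2 e i`, with speed of light
`1`. -/
structure IsLightFrame (R : P → P → Prop) (o a : P) (n n' x : Fin d → P) : Prop where
  not_rel : ¬R o a
  n_mem : ∀ i ≠ 0, n i ∈ coneInter R o a
  n'_mem : ∀ i ≠ 0, n' i ∈ coneInter R o a
  parallel : ∀ i ≠ 0, LightParallel R o (n i) a (n' i)
  x_mem : ∀ i ≠ 0, x i ∈ coneInter R a (n i)
  far_n : ∀ i ≠ 0, ∀ j ≠ 0, i ≠ j → LightFar R o (n j) (x i)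
  far_n' : ∀ i ≠ 0, ∀ j ≠ 0, i ≠ j → LightFar R o (n' j) (x i)

variable {R : P → P → Prop} {S : P' → P' → Prop} {p q p' q' x : P}

lemma map_mem_coneInter_iff (g : R ≃r S) {z : P} :
    g z ∈ coneInter S (g p) (g q) ↔ z ∈ coneInter R p q :=
  and_congr g.map_rel_iff g.map_rel_iff

lemma LightFar.map (g : R ≃r S) (h : LightFar R p q x) : LightFar S (g p) (g q) (g x) := by
  refine g.surjective.forall.2 fun z hz hzx => ?_
  exact h z ((map_mem_coneInter_iff g).1 hz) (g.map_rel_iff.1 hzx)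

lemma LightParallel.map (g : R ≃r S) (h : LightParallel R p q p' q') :
    LightParallel S (g p) (g q) (g p') (g q') := by
  refine g.surjective.forall.2 fun z hz => ?_
  rw [map_mem_coneInter_iff] at hz ⊢
  obtain ⟨y, hy, hyz⟩ := (h z hz).2
  exact ⟨(h z hz).1, g y, (map_mem_coneInter_iff g).2 hy, g.map_rel_iff.2 hyz⟩

lemma IsLightFrame.map (g : R ≃r S) {o a : P} {n n' x : Fin d → P}
    (h : IsLightFrame R o a n n' x) :
    IsLightFrame S (g o) (g a) (g ∘ n) (g ∘ n') (g ∘ x) where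
  not_rel := by rw [g.map_rel_iff]; exact h.not_rel
  n_mem i hi := (map_mem_coneInter_iff g).2 (h.n_mem i hi)
  n'_mem i hi := (map_mem_coneInter_iff g).2 (h.n'_mem i hi)
  parallel i hi := (h.parallel i hi).map g
  x_mem i hi := (map_mem_coneInter_iff g).2 (h.x_mem i hi)
  far_n i hi j hj hij := (h.far_n i hi j hj hij).map g
  far_n' i hi j hj hij := (h.far_n' i hi j hj hij).map g

end LightRelation


section MinkowskiForm

variable {d : ℕ} [NeZero d] {K : Type*} [Field K]

/-- The Minkowski form `c² x₀ y₀ - ∑ᵢ xᵢ yᵢ` with speed of light `c`, where `i` runs over the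
spatial indices `i ≠ 0`. -/
def minkowskiForm (d : ℕ) [NeZero d] (c : K) : BilinForm K (Fin d → K) :=
  Matrix.toBilin' (Matrix.diagonal fun i => if i = 0 then c ^ 2 else -1)

/-- Two points are light-related if their difference is a null vector. -/
def LightRel (c : K) (x y : Fin d → K) : Prop := minkowskiForm d c (y - x) (y - x) = 0

lemma minkowskiForm_isSymm (c : K) : (minkowskiForm d c).IsSymm :=
  Matrix.isSymm_toBilin'_iff_isSymm.2 (Matrix.isSymm_diagonal _)

lemma minkowskiForm_self (c : K) (x : Fin d → K) :
    minkowskiForm d c x x = c ^ 2 * x 0 ^ 2 - ∑ i ∈ Finset.univ.erase 0, x i ^ 2 := by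
  have hspace : ∑ i ∈ Finset.univ.erase (0 : Fin d), x i * ((if i = 0 then c ^ 2 else -1) * x i)
      = ∑ i ∈ Finset.univ.erase 0, -x i ^ 2 :=
    Finset.sum_congr rfl fun i hi => by rw [if_neg (Finset.ne_of_mem_erase hi)]; ring
  rw [minkowskiForm, Matrix.toBilin'_apply']
  simp only [dotProduct, Matrix.mulVec_diagonal]
  rw [← Finset.add_sum_erase _ _ (Finset.mem_univ 0), hspace, Finset.sum_neg_distrib, if_pos rfl]
  ring

lemma minkowskiForm_single_single (c : K) (i j : Fin d) :
    minkowskiForm d c (Pi.single i 1) (Pi.single j 1)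
      = if i = j then if i = 0 then c ^ 2 else -1 else 0 := by
  rw [minkowskiForm, Matrix.toBilin'_single, Matrix.diagonal_apply]

lemma minkowskiForm_single_zero_left (c : K) (x : Fin d → K) :
    minkowskiForm d c (Pi.single 0 1) x = c ^ 2 * x 0 := by
  simp [minkowskiForm, Matrix.toBilin'_apply', Matrix.mulVec_diagonal]

lemma lightRel_comm {c : K} {x y : Fin d → K} : LightRel c x y ↔ LightRel c y x := by
  rw [LightRel, LightRel, ← neg_sub x y, LinearMap.BilinForm.neg_left,
    LinearMap.BilinForm.neg_right, neg_neg]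

lemma det_diagonal_ite (s t : K) :
    (Matrix.diagonal fun i : Fin d => if i = 0 then s else t).det = s * t ^ (d - 1) := by
  rw [Matrix.det_diagonal, ← Finset.mul_prod_erase _ _ (Finset.mem_univ 0), if_pos rfl,
    Finset.prod_congr rfl fun i hi => if_neg (Finset.ne_of_mem_erase hi), Finset.prod_const,
    Finset.card_erase_of_mem (Finset.mem_univ _), Finset.card_univ, Fintype.card_fin]

lemma isSquare_det_gram (hd : Odd d) (c : K) (b : Fin d → Fin d → K) :
    IsSquare (Matrix.of fun i j => minkowskiForm d c (b i) (b j)).det := by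
  have hgram : (Matrix.of fun i j => minkowskiForm d c (b i) (b j))
      = Matrix.of b * (Matrix.diagonal fun i => if i = 0 then c ^ 2 else -1)
        * (Matrix.of b).transpose := by
    ext i j
    rw [Matrix.of_apply, minkowskiForm, Matrix.toBilin'_apply', Matrix.mul_assoc]
    rfl
  rw [hgram, Matrix.det_mul, Matrix.det_mul, Matrix.det_transpose, det_diagonal_ite,
    (Nat.Odd.sub_odd hd odd_one).neg_one_pow]
  exact ⟨(Matrix.of b).det * c, by ring⟩

lemma isSquare_of_orthogonal_frame (hd : Odd d) {c s : K} (hs : s ≠ 0) {b : Fin d → Fin d → K}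
    (hself : ∀ i, minkowskiForm d c (b i) (b i) = if i = 0 then s else -s)
    (hortho : ∀ i j, i ≠ j → minkowskiForm d c (b i) (b j) = 0) : IsSquare s := by
  have hgram : (Matrix.of fun i j => minkowskiForm d c (b i) (b j))
      = Matrix.diagonal fun i => if i = 0 then s else -s := by
    ext i j
    rcases eq_or_ne i j with rfl | hij
    · rw [Matrix.of_apply, hself, Matrix.diagonal_apply_eq]
    · rw [Matrix.of_apply, hortho i j hij, Matrix.diagonal_apply_ne _ hij]
  have heven : Even (d - 1) := Nat.Odd.sub_odd hd odd_one
  have hsq : IsSquare (s * s ^ (d - 1)) := by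
    rw [← heven.neg_pow s, ← det_diagonal_ite, ← hgram]
    exact isSquare_det_gram hd c b
  simpa [hs] using hsq.div (heven.isSquare_pow s)

lemma minkowskiForm_time_space_plane (c : K) {i : Fin d} (hi : i ≠ 0) (p q r s : K) :
    minkowskiForm d c (p • Pi.single 0 1 + q • Pi.single i 1)
      (r • Pi.single 0 1 + s • Pi.single i 1) = c ^ 2 * (p * r) - q * s := by
  simp only [LinearMap.BilinForm.add_left, LinearMap.BilinForm.add_right,
    LinearMap.BilinForm.smul_left, LinearMap.BilinForm.smul_right, minkowskiForm_single_single,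
    hi, hi.symm, if_true, if_false]
  ring

lemma lightRel_iff_of_sub_eq {c : K} {y z : Fin d → K} {i : Fin d} (hi : i ≠ 0) {p q : K}
    (h : z - y = p • Pi.single 0 1 + q • Pi.single i 1) :
    LightRel c y z ↔ c ^ 2 * p ^ 2 = q ^ 2 := by
  rw [LightRel, h, minkowskiForm_time_space_plane c hi, sub_eq_zero, sq p, sq q]

lemma ne_of_mem_coneInter {c : K} {o a : Fin d → K} (hoa : ¬LightRel c o a)
    {z : Fin d → K} (hz : z ∈ coneInter (LightRel c) o a) : o ≠ z ∧ a ≠ z :=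
  ⟨fun h => hoa (lightRel_comm.1 (h ▸ hz.2)), fun h => hoa (h ▸ hz.1)⟩

end MinkowskiForm


section NullLines

variable {d : ℕ} [NeZero d] {K : Type*} [Field K] [LinearOrder K] [IsStrictOrderedRing K] {c : K}

lemma eq_zero_of_null_of_time_eq_zero {x : Fin d → K} (hx : minkowskiForm d c x x = 0)
    (h0 : x 0 = 0) : x = 0 := by
  have hsum : ∑ i ∈ Finset.univ.erase 0, x i ^ 2 = 0 := by
    rw [minkowskiForm_self, h0] at hx
    linear_combination -hx
  rw [Finset.sum_eq_zero_iff_of_nonneg fun i _ => sq_nonneg (x i)] at hsum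
  funext i
  rcases eq_or_ne i 0 with rfl | hi
  · exact h0
  · exact pow_eq_zero_iff two_ne_zero |>.1 (hsum i (Finset.mem_erase.2 ⟨hi, Finset.mem_univ i⟩))

lemma exists_eq_smul_of_null_of_orthogonal {u w : Fin d → K} (hu : minkowskiForm d c u u = 0)
    (hw : minkowskiForm d c w w = 0) (huw : minkowskiForm d c u w = 0) (hne : u ≠ 0) :
    ∃ r : K, w = r • u := by
  have hu0 : u 0 ≠ 0 := fun h => hne (eq_zero_of_null_of_time_eq_zero hu h)
  refine ⟨w 0 / u 0, sub_eq_zero.1 (eq_zero_of_null_of_time_eq_zero (c := c) ?_ ?_)⟩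
  · rw [bilinForm_sub_smul_self (minkowskiForm_isSymm c) hu, hw, huw]
    ring
  · simp [hu0]

lemma eq_of_lightRel_iff (hc : c ≠ 0) {x y : Fin d → K}
    (h : ∀ z, LightRel c x z ↔ LightRel c y z) : x = y := by
  set n : Fin d → K := y - x with hn
  have hnull : minkowskiForm d c n n = 0 := (h y).2 (by simp [LightRel])
  -- the spatial reflection of `n`
  set m : Fin d → K := (2 * n 0) • Pi.single 0 1 - n with hm
  have hnm : minkowskiForm d c n m = 2 * (c * n 0) ^ 2 := by
    rw [hm, map_sub, hnull, map_smul, (minkowskiForm_isSymm c).eq, minkowskiForm_single_zero_left,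
      smul_eq_mul]
    ring
  have hmm : minkowskiForm d c m m = 0 := by
    have h0 : m 0 = n 0 := by simp [hm]; ring
    rw [hm, LinearMap.BilinForm.sub_left, LinearMap.BilinForm.smul_left,
      minkowskiForm_single_zero_left, ← hm, hnm, h0]
    ring
  have hym : minkowskiForm d c (m - n) (m - n) = 0 := by
    have := (h (x + m)).1 (by rwa [LightRel, add_sub_cancel_left])
    rwa [LightRel, show x + m - y = m - n by rw [hn]; abel] at this
  have h0 : n 0 = 0 := by
    have hsq : 4 * (c * n 0) ^ 2 = 0 := by
      have hexp := bilinForm_sub_smul_self (minkowskiForm_isSymm c) hnull m 1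
      rw [one_smul, hym, hmm, hnm] at hexp
      linear_combination hexp
    simpa [hc] using hsq
  exact (sub_eq_zero.1 (eq_zero_of_null_of_time_eq_zero hnull h0)).symm

lemma mem_coneInter_iff {p q z : Fin d → K} (hpq : LightRel c p q) :
    z ∈ coneInter (LightRel c) p q ↔
      minkowskiForm d c (z - p) (z - p) = 0 ∧ minkowskiForm d c (q - p) (z - p) = 0 := by
  refine and_congr_right fun hz => ?_
  have hexp := bilinForm_sub_smul_self (minkowskiForm_isSymm c) hpq (z - p) 1
  rw [one_smul, sub_sub_sub_cancel_right, hz] at hexp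
  rw [LightRel, hexp]
  simp

lemma mem_coneInter_iff_exists {p q z : Fin d → K} (hpq : LightRel c p q) (hne : p ≠ q) :
    z ∈ coneInter (LightRel c) p q ↔ ∃ r : K, z = p + r • (q - p) := by
  rw [mem_coneInter_iff hpq]
  constructor
  · rintro ⟨hz, hqz⟩
    obtain ⟨r, hr⟩ := exists_eq_smul_of_null_of_orthogonal hpq hz hqz (sub_ne_zero.2 hne.symm)
    exact ⟨r, by rw [← hr, add_sub_cancel]⟩
  · rintro ⟨r, rfl⟩
    have hnull : minkowskiForm d c (q - p) (q - p) = 0 := hpq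
    simp only [add_sub_cancel_left, LinearMap.BilinForm.smul_left, LinearMap.BilinForm.smul_right,
      hnull, mul_zero, and_self]

lemma exists_mem_coneInter_lightRel_iff {p q z : Fin d → K} (hpq : LightRel c p q) (hne : p ≠ q) :
    (∃ y ∈ coneInter (LightRel c) p q, LightRel c y z) ↔
      minkowskiForm d c (z - p) (z - p) = 0 ∨ minkowskiForm d c (q - p) (z - p) ≠ 0 := by
  rw [← exists_null_sub_smul_iff (minkowskiForm_isSymm c) hpq]
  constructor
  · rintro ⟨y, hy, hyz⟩
    obtain ⟨r, rfl⟩ := (mem_coneInter_iff_exists hpq hne).1 hy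
    exact ⟨r, by rwa [LightRel, ← sub_sub] at hyz⟩
  · rintro ⟨r, hr⟩
    exact ⟨_, (mem_coneInter_iff_exists hpq hne).2 ⟨r, rfl⟩, by rwa [LightRel, ← sub_sub]⟩

lemma lightFar_iff {p q x : Fin d → K} (hpq : LightRel c p q) (hne : p ≠ q) :
    LightFar (LightRel c) p q x ↔
      minkowskiForm d c (q - p) (x - p) = 0 ∧ ¬LightRel c p x := by
  have := (exists_mem_coneInter_lightRel_iff (z := x) hpq hne).not
  push Not at this
  rw [LightFar, this, and_comm]
  rfl

lemma lightParallel_iff {p q p' q' : Fin d → K} (hpq : LightRel c p q) (hne : p ≠ q)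
    (hpq' : LightRel c p' q') (hne' : p' ≠ q') :
    LightParallel (LightRel c) p q p' q' ↔
      minkowskiForm d c (q - p) (q' - p') = 0 ∧ minkowskiForm d c (p - p') (q' - p') ≠ 0 := by
  have hpoint : ∀ z, (z ∉ coneInter (LightRel c) p' q' ∧
      ∃ y ∈ coneInter (LightRel c) p' q', LightRel c y z) ↔
        minkowskiForm d c (z - p') (q' - p') ≠ 0 := by
    intro z
    rw [mem_coneInter_iff hpq', exists_mem_coneInter_lightRel_iff hpq' hne',
      (minkowskiForm_isSymm c).eq (z - p') (q' - p')]
    tauto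
  have hline : ∀ r : K, minkowskiForm d c (p + r • (q - p) - p') (q' - p')
      = minkowskiForm d c (p - p') (q' - p') + r * minkowskiForm d c (q - p) (q' - p') := by
    intro r
    rw [add_sub_right_comm, LinearMap.BilinForm.add_left, LinearMap.BilinForm.smul_left]
  simp only [LightParallel, hpoint, mem_coneInter_iff_exists hpq hne, forall_exists_index,
    forall_eq_apply_imp_iff, hline]
  constructor
  · intro h
    refine ⟨?_, by simpa using h 0⟩
    by_contra hqq
    exact h _ (by rw [div_mul_cancel₀ _ hqq, add_neg_cancel])
  · rintro ⟨hqq, hpp⟩ r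
    rwa [hqq, mul_zero, add_zero]

end NullLines


section LightFrame

variable {d : ℕ} [NeZero d] {K : Type*} [Field K] [LinearOrder K] [IsStrictOrderedRing K] {c : K}
  {o a : Fin d → K} {n n' x : Fin d → Fin d → K}

lemma orthogonal_of_lightFar (hoa : ¬LightRel c o a) {y z : Fin d → K}
    (hz : z ∈ coneInter (LightRel c) o a) (hzy : LightFar (LightRel c) o z y) :
    minkowskiForm d c (z - o) (y - o) = 0 :=
  ((lightFar_iff hz.1 (ne_of_mem_coneInter hoa hz).1).1 hzy).1

namespace IsLightFrame

variable (h : IsLightFrame (LightRel c) o a n n' x) {i j : Fin d}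
include h

lemma orthogonal_time (hi : i ≠ 0) (hj : j ≠ 0) (hij : i ≠ j) :
    minkowskiForm d c (a - o) (x i - o) = 0 := by
  have hn := h.n_mem j hj
  have hn' := h.n'_mem j hj
  have hon := (ne_of_mem_coneInter h.not_rel hn).1
  have han' := (ne_of_mem_coneInter h.not_rel hn').2
  obtain ⟨r, hr⟩ : ∃ r : K, n' j - a = r • (n j - o) :=
    exists_eq_smul_of_null_of_orthogonal hn.1 hn'.2
      ((lightParallel_iff hn.1 hon hn'.2 han').1 (h.parallel j hj)).1 (sub_ne_zero.2 hon.symm)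
  rw [← sub_sub_sub_cancel_left o a (n' j), hr, LinearMap.BilinForm.sub_left,
    LinearMap.BilinForm.smul_left, orthogonal_of_lightFar h.not_rel hn' (h.far_n' i hi j hj hij),
    orthogonal_of_lightFar h.not_rel hn (h.far_n i hi j hj hij), mul_zero, sub_zero]

lemma minkowskiForm_space_self (hi : i ≠ 0) (hai : minkowskiForm d c (a - o) (x i - o) = 0) :
    minkowskiForm d c (x i - o) (x i - o) = -minkowskiForm d c (a - o) (a - o) := by
  have hax : minkowskiForm d c (x i - a) (x i - a) = 0 := (h.x_mem i hi).1
  rw [← sub_sub_sub_cancel_right _ _ o] at hax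
  simp only [LinearMap.BilinForm.sub_left _ (a - o),
    LinearMap.BilinForm.sub_right _ (x i - o), hai,
    (minkowskiForm_isSymm c).eq (x i - o) (a - o)] at hax
  linear_combination hax

lemma orthogonal_space (hi : i ≠ 0) (hj : j ≠ 0) (hij : i ≠ j)
    (hai : minkowskiForm d c (a - o) (x i - o) = 0) :
    minkowskiForm d c (x j - o) (x i - o) = 0 := by
  have hn := h.n_mem j hj
  obtain ⟨r, hr⟩ := (mem_coneInter_iff_exists hn.2 (ne_of_mem_coneInter h.not_rel hn).2).1
    (h.x_mem j hj)
  have hxj : x j - o = (1 - r) • (a - o) + r • (n j - o) := by rw [hr]; module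
  rw [hxj, LinearMap.BilinForm.add_left, LinearMap.BilinForm.smul_left,
    LinearMap.BilinForm.smul_left, hai,
    orthogonal_of_lightFar h.not_rel hn (h.far_n i hi j hj hij), mul_zero, mul_zero, add_zero]

end IsLightFrame

lemma exists_ne_zero_ne (hd : 2 < d) (i : Fin d) : ∃ j : Fin d, j ≠ 0 ∧ i ≠ j := by
  have hcard : ({0, i} : Finset (Fin d)).card < (Finset.univ : Finset (Fin d)).card := by
    rw [Finset.card_univ, Fintype.card_fin]
    exact Finset.card_le_two.trans_lt hd
  obtain ⟨j, -, hj⟩ := Finset.exists_mem_notMem_of_card_lt_card hcard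
  rw [Finset.mem_insert, Finset.mem_singleton, not_or] at hj
  exact ⟨j, hj.1, Ne.symm hj.2⟩

theorem IsLightFrame.isSquare (hd : Odd d) (hd1 : d ≠ 1)
    (h : IsLightFrame (LightRel c) o a n n' x) :
    IsSquare (minkowskiForm d c (a - o) (a - o)) := by
  have hd2 : 2 < d := by obtain ⟨k, rfl⟩ := hd; omega
  have htime : ∀ i ≠ 0, minkowskiForm d c (a - o) (x i - o) = 0 := fun i hi =>
    let ⟨_, hj, hij⟩ := exists_ne_zero_ne hd2 i
    h.orthogonal_time hi hj hij
  refine isSquare_of_orthogonal_frame (c := c) hd h.not_rel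
    (b := fun i => if i = 0 then a - o else x i - o) (fun i => ?_) fun i j hij => ?_
  · by_cases hi : i = 0
    · simp only [if_pos hi]
    · simp only [if_neg hi]
      exact h.minkowskiForm_space_self hi (htime i hi)
  · by_cases hi : i = 0 <;> by_cases hj : j = 0
    · exact absurd (hi.trans hj.symm) hij
    · simp only [if_pos hi, if_neg hj]
      exact htime j hj
    · simp only [if_neg hi, if_pos hj]
      rw [(minkowskiForm_isSymm c).eq]
      exact htime i hi
    · simp only [if_neg hi, if_neg hj]
      exact h.orthogonal_space hj hi hij.symm (htime j hj)

lemma isLightFrame_of_time_axis (hc : c ≠ 0) (o : Fin d → K) {t : K} (ht : t ≠ 0) :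
    let e : Fin d → Fin d → K := fun i => Pi.single i 1
    IsLightFrame (LightRel c) o (o + (2 * t) • e 0) (fun i => o + t • (e 0 + c • e i))
      (fun i => o + t • (e 0 + (-c) • e i)) (fun i => o + (2 * t * c) • e i) := by
  intro e
  have hoa : ¬LightRel c o (o + (2 * t) • e 0) := by
    simp [LightRel, e, minkowskiForm_single_single, hc, ht]
  have hmem : ∀ i ≠ 0, ∀ s, s ^ 2 = c ^ 2 →
      o + t • (e 0 + s • e i) ∈ coneInter (LightRel c) o (o + (2 * t) • e 0) :=
    fun i hi s hs => ⟨(lightRel_iff_of_sub_eq hi (p := t) (q := t * s) (by module)).2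
        (by rw [mul_pow, hs, mul_comm]),
      (lightRel_iff_of_sub_eq hi (p := -t) (q := t * s) (by module)).2
        (by rw [mul_pow, hs, neg_sq, mul_comm])⟩
  have hne : ∀ i ≠ 0, ∀ s, s ^ 2 = c ^ 2 →
      o ≠ o + t • (e 0 + s • e i) ∧ o + (2 * t) • e 0 ≠ o + t • (e 0 + s • e i) :=
    fun i hi s hs => ne_of_mem_coneInter hoa (hmem i hi s hs)
  have hfar : ∀ i ≠ 0, ∀ j ≠ 0, i ≠ j → ∀ s, s ^ 2 = c ^ 2 →
      LightFar (LightRel c) o (o + t • (e 0 + s • e j)) (o + (2 * t * c) • e i) := by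
    intro i hi j hj hij s hs
    rw [lightFar_iff (hmem j hj s hs).1 (hne j hj s hs).1, add_sub_cancel_left,
      add_sub_cancel_left]
    constructor
    · simp [e, minkowskiForm_single_single, hi.symm, hij.symm]
    · simp [LightRel, e, minkowskiForm_single_single, hi, hc, ht]
  refine ⟨hoa, fun i hi => hmem i hi c rfl, fun i hi => hmem i hi (-c) (neg_sq c), fun i hi => ?_,
    fun i hi => ⟨?_, ?_⟩, fun i hi j hj hij => hfar i hi j hj hij c rfl,
    fun i hi j hj hij => hfar i hi j hj hij (-c) (neg_sq c)⟩
  · rw [lightParallel_iff (hmem i hi c rfl).1 (hne i hi c rfl).1 (hmem i hi (-c) (neg_sq c)).2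
      (hne i hi (-c) (neg_sq c)).2,
      show o + t • (e 0 + c • e i) - o = t • e 0 + (t * c) • e i by module,
      show o - (o + (2 * t) • e 0) = (-(2 * t)) • e 0 + (0 : K) • e i by module,
      show o + t • (e 0 + (-c) • e i) - (o + (2 * t) • e 0) = (-t) • e 0 + (-(t * c)) • e i by
        module,
      minkowskiForm_time_space_plane c hi, minkowskiForm_time_space_plane c hi]
    exact ⟨by ring, by simp [hc, ht]⟩
  · exact (lightRel_iff_of_sub_eq hi (p := -(2 * t)) (q := 2 * t * c) (by module)).2 (by ring)
  · exact (lightRel_iff_of_sub_eq hi (p := -t) (q := t * c) (by module)).2 (by ring)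

end LightFrame

namespace Model

variable {d : ℕ} {M : Model.{u} d}

/-- Two events are light-connected if a light signal is present at both of them. -/
def LightConnected (M : Model.{u} d) (E F : Set M.Body) : Prop := ∃ p, M.Ph p ∧ p ∈ E ∧ p ∈ F

lemma AxEv.range_ev_eq (hEv : M.AxEv) {m k : M.Body} (hm : M.IOb m) (hk : M.IOb k) :
    Set.range (M.ev m) = Set.range (M.ev k) := by
  refine Set.Subset.antisymm ?_ ?_
  · rintro _ ⟨x, rfl⟩
    obtain ⟨y, hy⟩ := hEv m k hm hk x
    exact ⟨y, hy.symm⟩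
  · rintro _ ⟨x, rfl⟩
    obtain ⟨y, hy⟩ := hEv k m hk hm x
    exact ⟨y, hy.symm⟩

variable [NeZero d] [OrderedFieldStructure M.quantityPart]

lemma minkowskiForm_sub_self (c : M.Q) (x y : Fin d → M.Q) :
    minkowskiForm d c (y - x) (y - x) = c ^ 2 * M.time x y ^ 2 - M.space2 x y := by
  simp only [minkowskiForm_self, time, space2, Pi.sub_apply, sub_sq_comm]

lemma lightRel_iff_space2_eq {c : M.Q} {x y : Fin d → M.Q} :
    LightRel c x y ↔ M.space2 x y = c ^ 2 * M.time x y ^ 2 := by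
  rw [LightRel, minkowskiForm_sub_self, sub_eq_zero, eq_comm]

lemma AxPh.exists_lightConnected_iff (hPh : M.AxPh) {m : M.Body} (hm : M.IOb m) :
    ∃ c : M.Q, 0 < c ∧
      ∀ x y, M.LightConnected (M.ev m x) (M.ev m y) ↔ LightRel c x y := by
  obtain ⟨c, hc, hlight⟩ := hPh m hm
  exact ⟨c, hc, fun x y => (hlight x y).trans lightRel_iff_space2_eq.symm⟩

lemma isLightSpeed_of_lightConnected_iff {m : M.Body} {c : M.Q} (hc : 0 < c)
    (hlight : ∀ x y, M.LightConnected (M.ev m x) (M.ev m y) ↔ LightRel c x y) :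
    M.IsLightSpeed m c :=
  ⟨hc, fun x y h => lightRel_iff_space2_eq.1 ((hlight x y).1 h)⟩

lemma ev_injective {m : M.Body} {c : M.Q} (hc : c ≠ 0)
    (hlight : ∀ x y, M.LightConnected (M.ev m x) (M.ev m y) ↔ LightRel c x y) :
    Function.Injective (M.ev m) := fun x y hxy =>
  eq_of_lightRel_iff hc fun z => by rw [← hlight x z, ← hlight y z, hxy]

lemma exists_worldviewTransformation (hEv : M.AxEv) {m k : M.Body} (hm : M.IOb m) (hk : M.IOb k)
    {c c' : M.Q} (hc : c ≠ 0) (hc' : c' ≠ 0)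
    (hlight : ∀ x y, M.LightConnected (M.ev m x) (M.ev m y) ↔ LightRel c x y)
    (hlight' : ∀ x y, M.LightConnected (M.ev k x) (M.ev k y) ↔ LightRel c' x y) :
    ∃ g : LightRel (d := d) c ≃r LightRel (d := d) c', ∀ x, M.ev k (g x) = M.ev m x := by
  let g : (Fin d → M.Q) ≃ (Fin d → M.Q) :=
    (Equiv.ofInjective _ (ev_injective hc hlight)).trans
      ((Equiv.setCongr (hEv.range_ev_eq hm hk)).trans
        (Equiv.ofInjective _ (ev_injective hc' hlight')).symm)
  have hg : ∀ x, M.ev k (g x) = M.ev m x := fun x =>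
    Equiv.apply_ofInjective_symm (ev_injective hc' hlight') _
  exact ⟨⟨g, by intro x y; rw [← hlight, ← hlight', hg, hg]⟩, hg⟩

lemma AxSelf.eq_add_smul_of_mem_worldline (hSelf : M.AxSelf) {k : M.Body} (hk : M.IOb k)
    {x y : Fin d → M.Q} (hx : M.W k k x) (hy : M.W k k y) :
    y = x + (y 0 - x 0) • Pi.single 0 1 := by
  funext i
  rcases eq_or_ne i 0 with rfl | hi
  · simp
  · simp [hi, (hSelf k hk x).1 hx i hi, (hSelf k hk y).1 hy i hi]

lemma isSquare_minkowskiForm_of_worldline (hd : Odd d) (hd1 : d ≠ 1) (hPh : M.AxPh)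
    (hEv : M.AxEv) (hSelf : M.AxSelf) {m k : M.Body} (hm : M.IOb m) (hk : M.IOb k) {c : M.Q}
    (hc : c ≠ 0) (hlight : ∀ x y, M.LightConnected (M.ev m x) (M.ev m y) ↔ LightRel c x y)
    {x y : Fin d → M.Q} (hx : M.W m k x) (hy : M.W m k y) (hxy : x ≠ y) :
    IsSquare (minkowskiForm d c (y - x) (y - x)) := by
  obtain ⟨c', hc', hlight'⟩ := hPh.exists_lightConnected_iff hk
  obtain ⟨g, hg⟩ := exists_worldviewTransformation hEv hm hk hc hc'.ne' hlight hlight'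
  have hW : ∀ {z}, M.W m k z → M.W k k (g z) := fun hz => (Set.ext_iff.1 (hg _) k).2 hz
  obtain ⟨t, ht⟩ : ∃ t : M.Q, g y = g x + (2 * t) • Pi.single 0 1 :=
    ⟨(g y 0 - g x 0) / 2, by
      rw [mul_div_cancel₀ _ two_ne_zero]
      exact hSelf.eq_add_smul_of_mem_worldline hk (hW hx) (hW hy)⟩
  have ht0 : t ≠ 0 := by
    rintro rfl
    exact hxy (g.injective (by rw [ht, mul_zero, zero_smul, add_zero]))
  have hframe := (isLightFrame_of_time_axis hc'.ne' (g x) ht0).map g.symm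
  rw [← ht, g.symm_apply_apply, g.symm_apply_apply] at hframe
  exact hframe.isSquare hd hd1

lemma AxThExp.exists_worldline (hThExp : M.AxThExp) {m : M.Body} (hm : M.IOb m) {c : M.Q}
    (hc : M.IsLightSpeed m c) {x y : Fin d → M.Q} (hxy : 0 < minkowskiForm d c (y - x) (y - x)) :
    ∃ k, M.IOb k ∧ M.W m k x ∧ M.W m k y :=
  hThExp.2 m hm c hc x y (by rwa [minkowskiForm_sub_self, sub_pos] at hxy)

lemma isSquare_of_pos (hd : Odd d) (hd1 : d ≠ 1) (hPh : M.AxPh) (hEv : M.AxEv)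
    (hSelf : M.AxSelf) (hThExp : M.AxThExp) {α : M.Q} (hα : 0 < α) : IsSquare α := by
  obtain ⟨m, hm⟩ := hThExp.1
  obtain ⟨c, hc, hlight⟩ := hPh.exists_lightConnected_iff hm
  obtain ⟨i, hi⟩ : ∃ i : Fin d, i ≠ 0 := by
    have : Nontrivial (Fin d) := Fin.nontrivial_iff_two_le.2 (by obtain ⟨k, rfl⟩ := hd; omega)
    exact exists_ne 0
  -- `((1 + α) / 2) ^ 2 - ((1 - α) / 2) ^ 2 = α`
  let y : Fin d → M.Q := ((1 + α) / 2) • Pi.single 0 1 + (c * ((1 - α) / 2)) • Pi.single i 1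
  have hy : minkowskiForm d c (y - 0) (y - 0) = c ^ 2 * α := by
    rw [sub_zero, minkowskiForm_time_space_plane c hi]
    ring
  have hpos : 0 < c ^ 2 * α := by positivity
  obtain ⟨k, hk, hk0, hky⟩ :=
    hThExp.exists_worldline hm (isLightSpeed_of_lightConnected_iff hc hlight) (hy ▸ hpos)
  have hne : 0 ≠ y := by
    intro h
    rw [← h, sub_zero, map_zero] at hy
    exact hpos.ne hy
  have hsq :=
    isSquare_minkowskiForm_of_worldline hd hd1 hPh hEv hSelf hm hk hc.ne' hlight hk0 hky hne
  rw [hy] at hsq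
  simpa [hc.ne'] using hsq.div (IsSquare.sq c)

end Model

section Poincare

variable {d : ℕ} [NeZero d] {K : Type*} [Field K]

/-- The Poincaré group: the bijections of `Kᵈ` that preserve the Minkowski form, with speed of
light `1`, of differences. -/
def poincareGroup (d : ℕ) [NeZero d] (K : Type*) [Field K] : Subgroup (Equiv.Perm (Fin d → K)) where
  carrier := {f | ∀ x y, minkowskiForm d 1 (f y - f x) (f y - f x) =
    minkowskiForm d 1 (y - x) (y - x)}
  one_mem' _ _ := rfl
  mul_mem' hf hg x y := (hf _ _).trans (hg x y)
  inv_mem' {f} hf x y := by simpa using (hf (f⁻¹ x) (f⁻¹ y)).symm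

lemma lightRel_apply_iff (f : poincareGroup d K) {x y : Fin d → K} :
    LightRel 1 (f.1 x) (f.1 y) ↔ LightRel 1 x y := by
  rw [LightRel, f.2, LightRel]

lemma exists_isOrthogonal_apply_eq_time [NeZero (2 : K)] {v : Fin d → K} {r : K} (hr : r ≠ 0)
    (hv : minkowskiForm d 1 v v = r ^ 2) :
    ∃ (σ : (Fin d → K) ≃ₗ[K] (Fin d → K)) (s : K),
      (minkowskiForm d 1).IsOrthogonal σ ∧ σ v = s • Pi.single 0 1 := by
  obtain ⟨s, hs, hs0, hsv⟩ : ∃ s : K, s ^ 2 = r ^ 2 ∧ s ≠ 0 ∧ s ≠ v 0 := by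
    rcases ne_or_eq r (v 0) with hrv | hrv
    · exact ⟨r, rfl, hr, hrv⟩
    · refine ⟨-r, neg_sq r, neg_ne_zero.2 hr, fun h => hr ?_⟩
      exact (mul_eq_zero.1 (show 2 * r = 0 by linear_combination hrv - h)).resolve_left two_ne_zero
  have htime : minkowskiForm d 1 (s • Pi.single 0 1) (s • Pi.single 0 1) = s ^ 2 := by
    simp [minkowskiForm_single_single, sq]
  have hdiff : minkowskiForm d 1 (v - s • Pi.single 0 1) (v - s • Pi.single 0 1)
      = 2 * (s * (s - v 0)) := by
    rw [LinearMap.BilinForm.sub_left, LinearMap.BilinForm.sub_right,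
      LinearMap.BilinForm.sub_right, htime, hv, (minkowskiForm_isSymm 1).eq v,
      LinearMap.BilinForm.smul_left, minkowskiForm_single_zero_left, ← hs]
    ring
  obtain ⟨σ, hσ, hσv⟩ := exists_isOrthogonal_apply_eq (minkowskiForm_isSymm (1 : K))
    (hv.trans (hs.symm.trans htime.symm))
    (by rw [hdiff]; exact mul_ne_zero two_ne_zero (mul_ne_zero hs0 (sub_ne_zero.2 hsv)))
  exact ⟨σ, s, hσ, hσv⟩

lemma exists_mem_poincareGroup [NeZero (2 : K)] {x y : Fin d → K} {r : K} (hr : r ≠ 0)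
    (hxy : minkowskiForm d 1 (y - x) (y - x) = r ^ 2) :
    ∃ f ∈ poincareGroup d K, ∀ i ≠ 0, f x i = 0 ∧ f y i = 0 := by
  obtain ⟨σ, s, hσ, hσv⟩ := exists_isOrthogonal_apply_eq_time hr hxy
  refine ⟨(Equiv.subRight x).trans σ.toEquiv, fun a b => ?_, fun i hi => ?_⟩
  · simpa [map_sub] using hσ (b - a) (b - a)
  · simp [hσv, hi]

end Poincare

section LightLine

variable {d : ℕ} [NeZero d] {K : Type*} [Field K]

/-- A light line of Minkowski spacetime with speed of light `1`, given by one of its points and a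
nonzero null vector. -/
structure LightLine (d : ℕ) [NeZero d] (K : Type*) [Field K] where
  base : Fin d → K
  dir : Fin d → K
  dir_ne_zero : dir ≠ 0
  dir_null : minkowskiForm d 1 dir dir = 0

/-- The set of points on a light line. -/
def LightLine.points (p : LightLine d K) : Set (Fin d → K) := {x | ∃ s : K, x = p.base + s • p.dir}

lemma LightLine.lightRel (p : LightLine d K) {x y : Fin d → K} (hx : x ∈ p.points)
    (hy : y ∈ p.points) : LightRel 1 x y := by
  obtain ⟨s, rfl⟩ := hx
  obtain ⟨t, rfl⟩ := hy
  simp [LightRel, ← sub_smul, p.dir_null]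

lemma exists_ne_zero_null [Nontrivial (Fin d)] :
    ∃ v : Fin d → K, v 0 = 1 ∧ minkowskiForm d 1 v v = 0 := by
  obtain ⟨i, hi⟩ := exists_ne (0 : Fin d)
  refine ⟨(1 : K) • Pi.single 0 1 + (1 : K) • Pi.single i 1, by simp [hi.symm], ?_⟩
  rw [minkowskiForm_time_space_plane 1 hi]
  ring

lemma exists_lightLine_iff [Nontrivial (Fin d)] {x y : Fin d → K} :
    (∃ p : LightLine d K, x ∈ p.points ∧ y ∈ p.points) ↔ LightRel 1 x y := by
  refine ⟨fun ⟨p, hx, hy⟩ => p.lightRel hx hy, fun hxy => ?_⟩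
  rcases eq_or_ne x y with rfl | hne
  · obtain ⟨v, hv0, hv⟩ := exists_ne_zero_null (d := d) (K := K)
    have hvne : v ≠ 0 := by
      rintro rfl
      exact zero_ne_one hv0
    exact ⟨⟨x, v, hvne, hv⟩, ⟨0, by simp⟩, ⟨0, by simp⟩⟩
  · exact ⟨⟨x, y - x, sub_ne_zero.2 hne.symm, hxy⟩, ⟨0, by simp⟩, ⟨1, by simp⟩⟩

end LightLine

/-- Minkowski spacetime over an ordered field: the inertial observers are the Poincaré
transformations (from their own coordinates to fixed reference coordinates), the light signals
are the light lines of the reference coordinates. -/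
abbrev minkowskiModel (d : ℕ) [NeZero d] (𝔔 : QuantityStructure.{u}) [OrderedFieldStructure 𝔔] :
    Model.{u} d where
  quantityPart := 𝔔
  Body := poincareGroup d 𝔔.carrier ⊕ LightLine d 𝔔.carrier
  body_nonempty := ⟨.inl 1⟩
  Ob b := b ∈ Set.range Sum.inl
  IOb b := b ∈ Set.range Sum.inl
  Ph b := b ∈ Set.range Sum.inr
  W
    | .inl m, .inl k, x => ∀ i ≠ 0, (k⁻¹ * m).1 x i = 0
    | .inl m, .inr p, x => m.1 x ∈ p.points
    | .inr _, _, _ => False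

namespace minkowskiModel

open Model

variable (d : ℕ) [NeZero d] (𝔔 : QuantityStructure.{u}) [OrderedFieldStructure 𝔔]

lemma exists_photon_iff [Nontrivial (Fin d)] (m : poincareGroup d 𝔔.carrier)
    {x y : Fin d → 𝔔.carrier} :
    (∃ p, (minkowskiModel d 𝔔).Ph p ∧ (minkowskiModel d 𝔔).W (.inl m) p x ∧
      (minkowskiModel d 𝔔).W (.inl m) p y) ↔ LightRel 1 x y := by
  rw [← lightRel_apply_iff m, ← exists_lightLine_iff]
  exact Set.exists_range_iff

lemma axPh [Nontrivial (Fin d)] : (minkowskiModel d 𝔔).AxPh := by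
  rintro _ ⟨m, rfl⟩
  exact ⟨1, one_pos, fun x y => (exists_photon_iff d 𝔔 m).trans
    (lightRel_iff_space2_eq (M := minkowskiModel d 𝔔))⟩

lemma axEv : (minkowskiModel d 𝔔).AxEv := by
  rintro _ _ ⟨m, rfl⟩ ⟨k, rfl⟩ x
  refine ⟨(k⁻¹ * m).1 x, ?_⟩
  ext (b | b) <;> simp [ev]

lemma axSelf : (minkowskiModel d 𝔔).AxSelf := by
  rintro _ ⟨m, rfl⟩ x
  simp

lemma sq_eq_one_of_isLightSpeed [Nontrivial (Fin d)] {m : poincareGroup d 𝔔.carrier}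
    {c : 𝔔.carrier} (hc : (minkowskiModel d 𝔔).IsLightSpeed (.inl m) c) : c ^ 2 = 1 := by
  obtain ⟨v, hv0, hv⟩ := exists_ne_zero_null (d := d) (K := 𝔔.carrier)
  have h1 : LightRel 1 0 v := by rwa [LightRel, sub_zero]
  have hc' := hc.2 0 v ((exists_photon_iff d 𝔔 m).2 h1)
  have h1' := lightRel_iff_space2_eq (M := minkowskiModel d 𝔔).1 h1
  simpa [time, hv0] using hc'.symm.trans h1'

lemma axThExp [Nontrivial (Fin d)]
    (hsqrt : ∀ α : 𝔔.carrier, 0 < α → ∃ r : 𝔔.carrier, r ^ 2 = α) :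
    (minkowskiModel d 𝔔).AxThExp := by
  refine ⟨⟨_, 1, rfl⟩, ?_⟩
  rintro _ ⟨m, rfl⟩ c hc x y hxy
  have hpos : 0 < minkowskiForm d (1 : 𝔔.carrier) (m.1 y - m.1 x) (m.1 y - m.1 x) := by
    rw [sq_eq_one_of_isLightSpeed d 𝔔 hc, ← one_pow 2] at hxy
    rw [m.2, minkowskiForm_sub_self (M := minkowskiModel d 𝔔)]
    exact sub_pos.2 hxy
  obtain ⟨r, hr⟩ := hsqrt _ hpos
  have hr0 : r ≠ 0 := by
    rintro rfl
    rw [← hr, sq, zero_mul] at hpos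
    exact hpos.false
  obtain ⟨f, hf, hfxy⟩ := exists_mem_poincareGroup hr0 hr.symm
  refine ⟨_, ⟨⟨f, hf⟩⁻¹, rfl⟩, fun i hi => ?_, fun i hi => ?_⟩
  · simpa using (hfxy i hi).1
  · simpa using (hfxy i hi).2

end minkowskiModel

end SpaceTime

open SpaceTime in
theorem theorem3p8_general {d : ℕ} [NeZero d] (hd : Odd d) (hd1 : d ≠ 1) :
    SpaceTime.Num.{u} d Model.SpecRel₀AxThExp = {𝔔 | 𝔔.IsEuclideanField} := by
  ext 𝔔
  constructor
  · rintro ⟨M, ⟨inst, hPh, hEv, hSelf, hThExp⟩, rfl⟩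
    refine ⟨inst, fun α hα => ?_⟩
    obtain ⟨r, hr⟩ := Model.isSquare_of_pos hd hd1 hPh hEv hSelf hThExp hα
    exact ⟨r, by rw [hr, sq]⟩
  · rintro ⟨inst, hsqrt⟩
    have : Nontrivial (Fin d) :=
      Fin.nontrivial_iff_two_le.2 (by have := NeZero.pos d; omega)
    exact ⟨minkowskiModel d 𝔔, ⟨inst, minkowskiModel.axPh d 𝔔, minkowskiModel.axEv d 𝔔,
      minkowskiModel.axSelf d 𝔔, minkowskiModel.axThExp d 𝔔 hsqrt⟩, rfl⟩

theorem theorem3p8 :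
    SpaceTime.Num.{u} 3 SpaceTime.Model.SpecRel₀AxThExp =
      {𝔔 : SpaceTime.QuantityStructure.{u} | 𝔔.IsEuclideanField} :=
  theorem3p8_general (by decide) (by decide)
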